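/- Let $\mathbf{Comp}$ be the category of compact Hausdorff spaces (compacta) and continuous maps, and let $F:\mathbf{Comp}\to\mathbf{Comp}$ be a functor. A continuous map $f:X\to Y$ is called skeletal if the preimage $f^{-1}(A)$ of every nowhere dense set $A\subset Y$ is nowhere dense in $X$. A commutative square of compacta with top map $\tilde f:\tilde X\to\tilde Y$, bottom map $f:X\to Y$ and vertical maps $p_X:\tilde X\to X$, $p_Y:\tilde Y\to Y$ is bicommutative if $\tilde f(p_X^{-1}(x))=p_Y^{-1}(f(x))$ for all $x\in X$. The functor $F$ is called - monomorphic (epimorphic) if it sends injective (surjective) maps to injective (surjective) maps; - continuous if it preserves limits of inverse spectra (indexed by non-empty directed partially ordered sets); - preimage preserving if it preserves the bicommutativity of squares with $f$ and $\tilde f$ injective; - finite 1-preimage preserving if it preserves the bicommutativity of squares with $f,\tilde f$ injective, $p_X$ bijective and $X$ finite; - 1-mec if it is monomorphic, epimorphic, continuous and preserves finite 1-preimages; - normal if it is monomorphic, epimorphic, continuous, preserves intersections of non-empty families of closed subsets (that is, for each compactum $X$ and each such family $\mathcal A$ of closed subsets of $X$, $F(\bigcap\mathcal A)=\bigcap_{A\in\mathcal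 A}F(A)$, where $F(A)$ is identified with its image in $F(X)$), preserves the empty set and the singleton, satisfies $w(FX)\le w(X)$ for the weights of $FX$ and $X$ for every infinite compactum $X$, and preserves preimages; - open if for every open surjection $f$ between compacta the map $Ff$ is open; - skeletal if for every skeletal surjection $f$ between compacta the map $Ff$ is skeletal. Corollary 1.2. Every open 1-mec functor $F:\mathbf{Comp}\to\mathbf{Comp}$ is skeletal. In particular, every open normal functor $F:\mathbf{Comp}\to\mathbf{Comp}$ is skeletal. -/

import Mathlib

open CategoryTheory CategoryTheory.Limits TopologicalSpace

universe u

/-- A map `f : X → Y` is skeletal if the preimage of each nowhere dense subset of `Y` is nowhere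
dense in `X`. -/
def IsSkeletalMap {X Y : Type*} [TopologicalSpace X] [TopologicalSpace Y] (f : X → Y) : Prop :=
  ∀ A : Set Y, IsNowhereDense A → IsNowhereDense (f ⁻¹' A)

/-- The weight of a topological space: the least cardinality of a base of its topology. -/
noncomputable def topWeight (X : Type u) [TopologicalSpace X] : Cardinal.{u} :=
  sInf {c : Cardinal.{u} | ∃ B : Set (Set X), IsTopologicalBasis B ∧ c = Cardinal.mk B}

namespace CompFunctor

/-- The square with top side `f'`, bottom side `f`, left side `pX` and right side `pY`
is bicommutative: it commutes and `f' (pX⁻¹ x) = pY⁻¹ (f x)` for all `x`. -/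
def IsBicommutative {X' Y' X Y : CompHaus.{u}} (f' : X' ⟶ Y') (pX : X' ⟶ X) (pY : Y' ⟶ Y)
    (f : X ⟶ Y) : Prop :=
  CommSq f' pX pY f ∧ ∀ x : X, f' '' (pX ⁻¹' {x}) = pY ⁻¹' {f x}

/-- `F` preserves injective maps. -/
def IsMonomorphic (F : CompHaus.{u} ⥤ CompHaus.{u}) : Prop :=
  ∀ ⦃X Y : CompHaus.{u}⦄ (f : X ⟶ Y), Function.Injective f → Function.Injective (F.map f)

/-- `F` preserves surjective maps. -/
def IsEpimorphic (F : CompHaus.{u} ⥤ CompHaus.{u}) : Prop :=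
  ∀ ⦃X Y : CompHaus.{u}⦄ (f : X ⟶ Y), Function.Surjective f → Function.Surjective (F.map f)

/-- `F` is continuous: it preserves the limits of inverse spectra, that is, of inverse systems
indexed by non-empty directed partially ordered sets. -/
def IsContinuousFunctor (F : CompHaus.{u} ⥤ CompHaus.{u}) : Prop :=
  ∀ (J : Type u) [PartialOrder J] [Nonempty J], (∀ i j : J, ∃ k, i ≤ k ∧ j ≤ k) →
    PreservesLimitsOfShape Jᵒᵖ F

/-- `F` is open: it sends open surjections to open maps. -/
def IsOpenFunctor (F : CompHaus.{u} ⥤ CompHaus.{u}) : Prop :=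
  ∀ ⦃X Y : CompHaus.{u}⦄ (f : X ⟶ Y), Function.Surjective f → IsOpenMap f → IsOpenMap (F.map f)

/-- `F` is skeletal: it sends skeletal surjections to skeletal maps. -/
def IsSkeletalFunctor (F : CompHaus.{u} ⥤ CompHaus.{u}) : Prop :=
  ∀ ⦃X Y : CompHaus.{u}⦄ (f : X ⟶ Y), Function.Surjective f → IsSkeletalMap f →
    IsSkeletalMap (F.map f)

/-- `F` preserves preimages. -/
def PreservesPreimages (F : CompHaus.{u} ⥤ CompHaus.{u}) : Prop :=
  ∀ ⦃X' Y' X Y : CompHaus.{u}⦄ (f' : X' ⟶ Y') (pX : X' ⟶ X) (pY : Y' ⟶ Y) (f : X ⟶ Y),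
    Function.Injective f' → Function.Injective f → IsBicommutative f' pX pY f →
      IsBicommutative (F.map f') (F.map pX) (F.map pY) (F.map f)

/-- `F` preserves finite 1-preimages. -/
def PreservesFiniteOnePreimages (F : CompHaus.{u} ⥤ CompHaus.{u}) : Prop :=
  ∀ ⦃X' Y' X Y : CompHaus.{u}⦄ (f' : X' ⟶ Y') (pX : X' ⟶ X) (pY : Y' ⟶ Y) (f : X ⟶ Y),
    Finite X → Function.Injective f' → Function.Injective f → Function.Bijective pX →
      IsBicommutative f' pX pY f → IsBicommutative (F.map f') (F.map pX) (F.map pY) (F.map f)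

/-- A closed subset of a compactum, as a compactum. -/
def closedSub (X : CompHaus.{u}) (A : Closeds X) : CompHaus.{u} :=
  haveI : CompactSpace (A : Set X) := isCompact_iff_compactSpace.mp A.isClosed.isCompact
  CompHaus.of (A : Set X)

/-- The inclusion map of a closed subset of a compactum. -/
def closedIncl (X : CompHaus.{u}) (A : Closeds X) : closedSub X A ⟶ X :=
  haveI : CompactSpace (A : Set X) := isCompact_iff_compactSpace.mp A.isClosed.isCompact
  CompHausLike.ofHom (X := (A : Set X)) (Y := X) _ ⟨Subtype.val, continuous_subtype_val⟩

/-- The copy of `F A` in `F X`, for a closed subset `A` of `X`. -/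
def closedImage (F : CompHaus.{u} ⥤ CompHaus.{u}) (X : CompHaus.{u}) (A : Closeds X) :
    Set (F.obj X) :=
  Set.range (F.map (closedIncl X A))

/-- `F` preserves intersections of (non-empty) families of closed subsets. -/
def PreservesIntersections (F : CompHaus.{u} ⥤ CompHaus.{u}) : Prop :=
  ∀ (X : CompHaus.{u}) (𝒜 : Set (Closeds X)), 𝒜.Nonempty →
    closedImage F X (sInf 𝒜) = ⋂ A ∈ 𝒜, closedImage F X A

/-- `F` preserves the empty set. -/
def PreservesEmpty (F : CompHaus.{u} ⥤ CompHaus.{u}) : Prop :=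
  ∀ X : CompHaus.{u}, IsEmpty X → IsEmpty (F.obj X)

/-- `F` preserves the singleton. -/
def PreservesSingleton (F : CompHaus.{u} ⥤ CompHaus.{u}) : Prop :=
  ∀ X : CompHaus.{u}, Nonempty X → Subsingleton X →
    Nonempty (F.obj X) ∧ Subsingleton (F.obj X)

/-- `F` is weight-preserving: `w(F X) ≤ w(X)` for each infinite compactum `X`. -/
def PreservesWeight (F : CompHaus.{u} ⥤ CompHaus.{u}) : Prop :=
  ∀ X : CompHaus.{u}, Infinite X → topWeight (F.obj X) ≤ topWeight X

/-- mec functors: monomorphic, epimorphic and continuous. -/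
structure IsMec (F : CompHaus.{u} ⥤ CompHaus.{u}) : Prop where
  monomorphic : IsMonomorphic F
  epimorphic : IsEpimorphic F
  continuous : IsContinuousFunctor F

/-- 1-mec functors: mec functors that preserve finite 1-preimages. -/
structure IsOneMec (F : CompHaus.{u} ⥤ CompHaus.{u}) : Prop extends IsMec F where
  finiteOnePreimages : PreservesFiniteOnePreimages F

/-- Weakly normal functors. -/
structure IsWeaklyNormal (F : CompHaus.{u} ⥤ CompHaus.{u}) : Prop extends IsMec F where
  intersections : PreservesIntersections F
  empty : PreservesEmpty F
  singleton : PreservesSingleton F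
  weight : PreservesWeight F

/-- Normal functors: weakly normal functors that preserve preimages. -/
structure IsNormal (F : CompHaus.{u} ⥤ CompHaus.{u}) : Prop extends IsWeaklyNormal F where
  preimages : PreservesPreimages F

end CompFunctor

/-! A continuous map is skeletal iff images of nonempty open sets are somewhere dense. Precomposing
with a skeletal cover reduces the theorem to surjections `f : X ⟶ Y` with `X` totally disconnected.
There continuity of `F` shrinks a neighbourhood of `a` in `F X` to one pulled back from `F K`, for a
finite quotient `q : X ⟶ K`. Skeletality gives every `f (q⁻¹ k)` nonempty interior, so points `y k`
can be chosen there, colliding only at isolated points of `Y`. Over a closed part of `X`, `f` then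
factors through `R ⟶ P ⟶ Y` (`exists_factorization_through_open`): the second map is open, and the
first is one-to-one over the points marked by a copy of `K` in `R`. Preserving finite 1-preimages
carries this uniqueness to `F` (`preimage_map_singleton`), so a closed-map argument yields an open
set in `F P`, whose image in `F Y` is open because `F` is open. -/

section Skeletal

/-! ### Skeletal maps -/

variable {X Y Z : Type*} [TopologicalSpace X] [TopologicalSpace Y] [TopologicalSpace Z]

/-- The image of a nonempty open set under a skeletal map is somewhere dense. -/
theorem IsSkeletalMap.nonempty_interior_closure_image {f : X → Y} (hf : IsSkeletalMap f)
    {U : Set X} (hU : IsOpen U) (hne : U.Nonempty) : (interior (closure (f '' U))).Nonempty := by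
  by_contra h
  have h1 : IsNowhereDense (f ⁻¹' (f '' U)) := hf _ (Set.not_nonempty_iff_eq_empty.mp h)
  have h2 : IsNowhereDense U := h1.mono (Set.subset_preimage_image f U)
  have h3 : U ⊆ interior (closure U) := hU.subset_interior_iff.mpr subset_closure
  rw [h2] at h3
  exact hne.ne_empty (Set.subset_empty_iff.mp h3)

/-- A continuous map is skeletal if it sends nonempty open sets to somewhere dense sets. -/
theorem isSkeletalMap_of_nonempty_interior_closure_image {f : X → Y} (hc : Continuous f)
    (h : ∀ U : Set X, IsOpen U → U.Nonempty → (interior (closure (f '' U))).Nonempty) :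
    IsSkeletalMap f := by
  intro A hA
  by_contra hne
  obtain ⟨y, hy⟩ := h _ isOpen_interior (Set.nonempty_iff_ne_empty.mpr hne)
  have hsub : f '' interior (closure (f ⁻¹' A)) ⊆ closure A := by
    rw [Set.image_subset_iff]
    exact interior_subset.trans (hc.closure_preimage_subset A)
  have : y ∈ interior (closure A) := interior_mono (closure_minimal hsub isClosed_closure) hy
  rw [hA] at this
  exact this

theorem IsSkeletalMap.comp {g : Y → Z} {f : X → Y} (hg : IsSkeletalMap g) (hf : IsSkeletalMap f) :
    IsSkeletalMap (g ∘ f) :=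
  fun A hA => hf _ (hg A hA)

/-- A nonempty open set of `Y` is the image of its nonempty open preimage in `X`, so `f` itself need
not be skeletal. -/
theorem IsSkeletalMap.of_comp_surjective {g : Y → Z} {f : X → Y} (hgf : IsSkeletalMap (g ∘ f))
    (hg : Continuous g) (hf : Continuous f) (hs : Function.Surjective f) : IsSkeletalMap g := by
  refine isSkeletalMap_of_nonempty_interior_closure_image hg fun U hU hne => ?_
  have := hgf.nonempty_interior_closure_image (hU.preimage hf) (hne.preimage hs)
  rwa [Set.image_comp, Set.image_preimage_eq U hs] at this

/-- An irreducible closed map is skeletal. -/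
theorem isSkeletalMap_of_irreducible {f : X → Y} (hc : Continuous f) (hcl : IsClosedMap f)
    (hs : Function.Surjective f)
    (h : ∀ E : Set X, E ≠ Set.univ → IsClosed E → f '' E ≠ Set.univ) : IsSkeletalMap f := by
  refine isSkeletalMap_of_nonempty_interior_closure_image hc fun U hU hne => ?_
  have h1 : f '' Uᶜ ≠ Set.univ := h _ (by simpa using hne.ne_empty) hU.isClosed_compl
  have h2 : (f '' Uᶜ)ᶜ.Nonempty := by
    rw [Set.nonempty_iff_ne_empty]; simpa using h1
  refine h2.mono (interior_maximal ?_ (hcl _ hU.isClosed_compl).isOpen_compl)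
  refine Set.Subset.trans ?_ subset_closure
  intro y hy
  obtain ⟨x, rfl⟩ := hs y
  by_contra hx
  exact hy ⟨x, fun hxU => hx ⟨x, hxU, rfl⟩, rfl⟩

end Skeletal

/-- In a `T₁` space, points of finitely many nonempty open sets can be chosen so that only isolated
points are chosen more than once. -/
theorem exists_choice_eq_imp_isolated {Y K : Type*} [TopologicalSpace Y] [T1Space Y] [Finite K]
    (G : K → Set Y) (hG : ∀ k, IsOpen (G k)) (hne : ∀ k, (G k).Nonempty) :
    ∃ y : K → Y, (∀ k, y k ∈ G k) ∧ ∀ k l, y k = y l → k = l ∨ IsOpen {y k} := by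
  classical
  have := Fintype.ofFinite K
  suffices h : ∀ s : Finset K, ∃ y : K → Y, (∀ k, y k ∈ G k) ∧
      ∀ k ∈ s, ∀ l ∈ s, y k = y l → k = l ∨ IsOpen {y k} by
    obtain ⟨y, hy, h⟩ := h Finset.univ
    exact ⟨y, hy, fun k l => h k (Finset.mem_univ k) l (Finset.mem_univ l)⟩
  intro s
  induction s using Finset.induction_on with
  | empty => exact ⟨fun k => (hne k).some, fun k => (hne k).some_mem, by simp⟩
  | insert a s ha ih =>
    obtain ⟨y, hy, h⟩ := ih
    obtain ⟨z, hzG, hz⟩ : ∃ z ∈ G a, IsOpen {z} ∨ z ∉ y '' (s : Set K) := by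
      by_cases hfin : G a ⊆ y '' (s : Set K)
      · have hGf : (G a).Finite := (s.finite_toSet.image y).subset hfin
        obtain ⟨z, hz⟩ := hne a
        refine ⟨z, hz, Or.inl ?_⟩
        -- Points of a finite open set in a `T₁` space are isolated: the other points form a closed
        -- set.
        have : ({z} : Set Y) = G a \ (G a \ {z}) := by
          rw [Set.sdiff_sdiff_cancel_left (Set.singleton_subset_iff.mpr hz)]
        rw [this]
        exact (hG a).sdiff (hGf.subset Set.sdiff_subset).isClosed
      · obtain ⟨z, hz, hz'⟩ := Set.not_subset.mp hfin
        exact ⟨z, hz, Or.inr hz'⟩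
    have hup : ∀ k ∈ s, Function.update y a z k = y k := fun k hk =>
      Function.update_of_ne (by rintro rfl; exact ha hk) _ _
    refine ⟨Function.update y a z, fun k => ?_, fun k hk l hl hkl => ?_⟩
    · by_cases hk : k = a
      · subst hk; simpa using hzG
      · simpa [hk] using hy k
    · rcases Finset.mem_insert.mp hk with rfl | hks <;> rcases Finset.mem_insert.mp hl with rfl | hls
      · exact Or.inl rfl
      · rw [hup l hls] at hkl
        rw [Function.update_self] at hkl ⊢
        exact hz.elim Or.inr fun hz => absurd ⟨l, hls, hkl.symm⟩ hz
      · rw [hup k hks] at hkl ⊢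
        rw [Function.update_self] at hkl
        exact hz.elim (fun hz => Or.inr (hkl ▸ hz)) fun hz => absurd ⟨k, hks, hkl⟩ hz
      · rw [hup k hks, hup l hls] at hkl
        rw [hup k hks]
        exact h k hks l hls hkl

/-! ### Finite quotients of profinite spaces under a continuous functor -/

namespace CompFunctor

theorem IsNormal.isOneMec {F : CompHaus.{u} ⥤ CompHaus.{u}} (h : IsNormal F) : IsOneMec F where
  toIsMec := h.toIsMec
  finiteOnePreimages _ _ _ _ f' pX pY f _ hf' hf _ hb := h.preimages f' pX pY f hf' hf hb

/-- A finite quotient detects a given neighbourhood of a point of `F X`, for `X` a profinite space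
and `F` a continuous functor. -/
theorem IsContinuousFunctor.exists_finite_quotient {F : CompHaus.{u} ⥤ CompHaus.{u}}
    (hF : IsContinuousFunctor F) (X : CompHaus.{u}) [TotallyDisconnectedSpace X]
    (W : Set (F.obj X)) (hW : IsOpen W) (a : F.obj X) (ha : a ∈ W) :
    ∃ (K : CompHaus.{u}) (q : X ⟶ K) (V : Set (F.obj K)), Finite K ∧ Function.Surjective q ∧
      IsOpen V ∧ F.map q a ∈ V ∧ F.map q ⁻¹' V ⊆ W := by
  let X' : Profinite.{u} := Profinite.of X
  have hpres : PreservesLimitsOfShape (DiscreteQuotient X') F := by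
    -- Finer quotients are smaller, so the directed index set is the order dual.
    have hdir : ∀ i j : (DiscreteQuotient X')ᵒᵈ, ∃ k, i ≤ k ∧ j ≤ k := fun i j =>
      ⟨i ⊔ j, le_sup_left, le_sup_right⟩
    have := hF (DiscreteQuotient X')ᵒᵈ hdir
    exact preservesLimitsOfShape_of_equiv
      ((orderDualEquivalence (DiscreteQuotient X')).op.trans (opOpEquivalence _)) F
  let c := compHausToTop.mapCone (F.mapCone (profiniteToCompHaus.mapCone X'.asLimitCone))
  have hc : IsLimit c := isLimitOfPreserves compHausToTop (isLimitOfPreserves F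
    (isLimitOfPreserves profiniteToCompHaus X'.asLimit))
  have hB := TopCat.isTopologicalBasis_cofiltered_limit _ _ hc (fun _ => {U | IsOpen U})
    (fun _ => isTopologicalBasis_opens) (fun _ => isOpen_univ) (fun _ _ _ h1 h2 => h1.inter h2)
    (fun i j f V hV => hV.preimage (TopCat.Hom.hom _).continuous)
  obtain ⟨_, ⟨S, V, hV, rfl⟩, haV, hVW⟩ := hB.exists_subset_of_mem_open ha hW
  refine ⟨profiniteToCompHaus.obj (X'.diagram.obj S), profiniteToCompHaus.map (X'.asLimitCone.π.app S),
    V, ?_, ?_, hV, haV, hVW⟩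
  · exact inferInstanceAs (Finite S)
  · exact S.proj_surjective

end CompFunctor

/-! ### Skeletal covers and the factorization -/

namespace CompFunctor

/-- Every compactum is the image of a totally disconnected one under a skeletal map. -/
theorem exists_skeletal_cover (X : CompHaus.{u}) :
    ∃ (E : CompHaus.{u}) (e : E ⟶ X), TotallyDisconnectedSpace E ∧ Function.Surjective e ∧
      IsSkeletalMap e := by
  -- The Stone–Čech compactification of discrete `X`; a minimal closed subset mapping onto `X` gives
  -- an irreducible map.
  let D : Type u := Ultrafilter X
  have hc : Continuous (Ultrafilter.extend (id : X → X)) := continuous_ultrafilter_extend id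
  have hs : Function.Surjective (Ultrafilter.extend (id : X → X)) := fun x =>
    ⟨pure x, congr_fun (ultrafilter_extend_extends (id : X → X)) x⟩
  have : T1Space X := T2Space.t1Space
  obtain ⟨E, hE, himg, hirr⟩ := exists_compact_surjective_zorn_subset hc hs
  have hcE : Continuous (E.domRestrict (Ultrafilter.extend (id : X → X))) :=
    hc.comp continuous_subtype_val
  have hsE : Function.Surjective (E.domRestrict (Ultrafilter.extend (id : X → X))) := fun x => by
    obtain ⟨d, hd, rfl⟩ : x ∈ Ultrafilter.extend (id : X → X) '' E := himg ▸ Set.mem_univ x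
    exact ⟨⟨d, hd⟩, rfl⟩
  exact ⟨CompHaus.of E, CompHausLike.ofHom _ ⟨_, hcE⟩,
    inferInstanceAs (TotallyDisconnectedSpace E), hsE,
    isSkeletalMap_of_irreducible hcE hcE.isClosedMap hsE hirr⟩

/-- Given a surjection `f : X ⟶ Y` and a finite quotient `q : X ⟶ K` whose fibres have images with
nonempty interior, the restriction of `f` to a closed subset `X₁` of `X` factors as a surjection
`g`, a surjection `p` and an open surjection `π`, such that the restriction of `q` factors through
`g` and `p` is one-to-one over the points `p (j k)` for a section `j`. -/
theorem exists_factorization_through_open {X Y K : CompHaus.{u}} [Finite K] (f : X ⟶ Y) (q : X ⟶ K)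
    (hf : Function.Surjective f) (hq : ∀ k, (interior (f '' (q ⁻¹' {k}))).Nonempty) :
    ∃ (X₁ R P : CompHaus.{u}) (i : X₁ ⟶ X) (g : X₁ ⟶ R) (r : R ⟶ K) (p : R ⟶ P) (π : P ⟶ Y)
      (j : K ⟶ R), i ≫ f = g ≫ p ≫ π ∧ i ≫ q = g ≫ r ∧ Function.Surjective g ∧
      Function.Surjective p ∧ Function.Surjective π ∧ IsOpenMap π ∧ j ≫ r = 𝟙 K ∧
      ∀ k z, p z = p (j k) → z = j k := by
  classical
  have : T1Space K := T2Space.t1Space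
  have : T1Space Y := T2Space.t1Space
  have : DiscreteTopology K := Finite.instDiscreteTopology
  obtain ⟨y, hy, hiso⟩ := exists_choice_eq_imp_isolated (Y := Y) _ (fun _ => isOpen_interior) hq
  obtain ⟨U, hU, hdisj⟩ := (Set.finite_range y).t2_separation
  let G : K → Set Y := fun k => U (y k) ∩ interior (f '' (q ⁻¹' {k}))
  have hGo : ∀ k, IsOpen (G k) := fun k => (hU _).2.inter isOpen_interior
  have hyG : ∀ k, y k ∈ G k := fun k => ⟨(hU _).1, hy k⟩
  have hG : ∀ k l z, z ∈ G k → z ∈ G l → y k = y l := fun k l z hk hl => by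
    by_contra hne
    exact Set.disjoint_left.mp (hdisj ⟨k, rfl⟩ ⟨l, rfl⟩ hne) hk.1 hl.1
  have hcf : Continuous f := f.hom.hom.continuous
  have hcq : Continuous q := q.hom.hom.continuous
  -- Near `y l`, keep only the labels that share this chosen point.
  let A : Set X := {x | ∀ l, f x ∈ G l → y (q x) = y l}
  have hA : IsClosed A := by
    have : A = ⋂ l, ((f ⁻¹' G l)ᶜ ∪ q ⁻¹' {k | y k = y l}) := by
      ext x
      simp only [A, Set.mem_ofPred_eq, Set.mem_iInter, Set.mem_union, Set.mem_compl_iff,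
        Set.mem_preimage, imp_iff_not_or]
    rw [this]
    exact isClosed_iInter fun l => ((hGo l).preimage hcf).isClosed_compl.union
      ((isClosed_discrete _).preimage hcq)
  have hAK : ∀ k, ∀ z ∈ G k, ∃ x ∈ A, f x = z ∧ q x = k := fun k z hz => by
    obtain ⟨x, hx, rfl⟩ := interior_subset hz.2
    have hx : q x = k := hx
    exact ⟨x, fun l hl => by rw [hx]; exact hG k l _ hz hl, rfl, hx⟩
  have hAY : ∀ z, ∃ x ∈ A, f x = z := fun z => by
    by_cases h : ∃ k, z ∈ G k
    · obtain ⟨k, hk⟩ := h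
      obtain ⟨x, hx, hxz, -⟩ := hAK k z hk
      exact ⟨x, hx, hxz⟩
    · obtain ⟨x, rfl⟩ := hf z
      exact ⟨x, fun l hl => absurd ⟨l, hl⟩ h, rfl⟩
  have : CompactSpace A := isCompact_iff_compactSpace.mp hA.isCompact
  let g₀ : A → Y × K := fun x => (f x, q x)
  have hg₀ : Continuous g₀ :=
    (hcf.comp continuous_subtype_val).prodMk (hcq.comp continuous_subtype_val)
  have : CompactSpace (Set.range g₀) := isCompact_iff_compactSpace.mp (isCompact_range hg₀)
  let I : Set Y := {z | z ∈ Set.range y ∧ IsOpen {z}}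
  have hIc : IsClopen I := by
    refine ⟨((Set.finite_range y).subset fun z hz => hz.1).isClosed, ?_⟩
    rw [isOpen_iff_forall_mem_open]
    exact fun z hz => ⟨{z}, Set.singleton_subset_iff.mpr hz, hz.2, rfl⟩
  let _ : TopologicalSpace (Option K) := ⊥
  have : DiscreteTopology (Option K) := ⟨rfl⟩
  -- Labels are forgotten except over chosen isolated points. Thus the projection to `Y` is
  -- one-to-one off the clopen set `I` and open over `I`.
  let p₀ : Set.range g₀ → Y × Option K := fun z => (z.1.1, if z.1.1 ∈ I then some z.1.2 else none)
  have hp₀ : Continuous p₀ := by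
    refine (continuous_fst.comp continuous_subtype_val).prodMk (Continuous.if ?_ ?_ ?_)
    · intro z hz
      have : frontier {z : Set.range g₀ | z.1.1 ∈ I} = ∅ :=
        (hIc.preimage (continuous_fst.comp continuous_subtype_val)).frontier_eq
      rw [this] at hz
      exact hz.elim
    · exact continuous_of_discreteTopology.comp (continuous_snd.comp continuous_subtype_val)
    · exact continuous_const
  have : CompactSpace (Set.range p₀) := isCompact_iff_compactSpace.mp (isCompact_range hp₀)
  have hj : ∀ k, (y k, k) ∈ Set.range g₀ := fun k => by
    obtain ⟨x, hx, h1, h2⟩ := hAK k (y k) (hyG k)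
    exact ⟨⟨x, hx⟩, Prod.ext h1 h2⟩
  have hπ : ∀ z : Y, ∃ w : Set.range g₀, w.1.1 = z := fun z => by
    obtain ⟨x, hx, rfl⟩ := hAY z
    exact ⟨⟨_, ⟨x, hx⟩, rfl⟩, rfl⟩
  refine ⟨CompHaus.of A, CompHaus.of (Set.range g₀), CompHaus.of (Set.range p₀),
    CompHausLike.ofHom _ ⟨Subtype.val, continuous_subtype_val⟩,
    CompHausLike.ofHom _ ⟨Set.rangeFactorization g₀, hg₀.subtype_mk _⟩,
    CompHausLike.ofHom _ ⟨fun z => z.1.2, continuous_snd.comp continuous_subtype_val⟩,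
    CompHausLike.ofHom _ ⟨Set.rangeFactorization p₀, hp₀.subtype_mk _⟩,
    CompHausLike.ofHom _ ⟨fun z => z.1.1, continuous_fst.comp continuous_subtype_val⟩,
    CompHausLike.ofHom _ ⟨fun k => ⟨(y k, k), hj k⟩, continuous_of_discreteTopology⟩,
    rfl, rfl, Set.rangeFactorization_surjective, Set.rangeFactorization_surjective, ?_, ?_, rfl, ?_⟩
  · intro z
    obtain ⟨w, rfl⟩ := hπ z
    exact ⟨⟨_, w, rfl⟩, rfl⟩
  · intro O hO
    obtain ⟨O', hO', rfl⟩ := isOpen_induced_iff.mp hO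
    rw [isOpen_iff_forall_mem_open]
    rintro _ ⟨⟨_, w, rfl⟩, hw, rfl⟩
    by_cases hwI : w.1.1 ∈ I
    · exact ⟨{w.1.1}, Set.singleton_subset_iff.mpr ⟨⟨_, w, rfl⟩, hw, rfl⟩, hwI.2, rfl⟩
    · refine ⟨Iᶜ ∩ (fun z => (z, none)) ⁻¹' O', ?_,
        hIc.compl.isOpen.inter (hO'.preimage (by fun_prop)), hwI, ?_⟩
      · rintro z ⟨hzI, hz⟩
        obtain ⟨v, rfl⟩ := hπ z
        refine ⟨⟨_, v, rfl⟩, ?_, rfl⟩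
        have : p₀ v = (v.1.1, none) := Prod.ext rfl (if_neg hzI)
        change p₀ v ∈ O'
        rw [this]
        exact hz
      · have : p₀ w = (w.1.1, none) := Prod.ext rfl (if_neg hwI)
        change (w.1.1, none) ∈ O'
        rw [← this]
        exact hw
  · rintro k ⟨⟨z, l⟩, x, hx⟩ hz
    have hp : p₀ ⟨(z, l), x, hx⟩ = p₀ ⟨(y k, k), hj k⟩ := congrArg Subtype.val hz
    obtain rfl : z = y k := congrArg Prod.fst hp
    have hl : y l = y k := by
      have h1 : f x = y k := congrArg Prod.fst hx
      have h2 : q x = l := congrArg Prod.snd hx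
      rw [← h2]
      exact x.2 k (h1 ▸ hyG k)
    -- Either the choice separates the labels, or `y k` is isolated and `p₀` remembers them.
    have hlk : l = k := by
      rcases hiso k l hl.symm with h | h
      · exact h.symm
      · have hI : y k ∈ I := ⟨⟨k, rfl⟩, h⟩
        have h3 : (if y k ∈ I then some l else none) = if y k ∈ I then some k else none :=
          congrArg Prod.snd hp
        rw [if_pos hI, if_pos hI] at h3
        exact Option.some.inj h3
    subst hlk
    rfl

/-- A functor preserving finite `1`-preimages preserves the property of a map to be one-to-one over
the points of a finite set. -/
theorem PreservesFiniteOnePreimages.preimage_map_singleton {F : CompHaus.{u} ⥤ CompHaus.{u}}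
    (hF : PreservesFiniteOnePreimages F) {K R P : CompHaus.{u}} [Finite K] (p : R ⟶ P) (j : K ⟶ R)
    (hj : Function.Injective j) (hp : ∀ k z, p z = p (j k) → z = j k) (b : F.obj K) :
    F.map p ⁻¹' {F.map p (F.map j b)} = {F.map j b} := by
  have hjp : Function.Injective (j ≫ p) := fun k l h => hj (hp l (j k) h)
  have hsq : IsBicommutative j (𝟙 K) p (j ≫ p) := by
    refine ⟨⟨by simp⟩, fun k => ?_⟩
    ext z
    constructor
    · rintro ⟨l, rfl, rfl⟩
      rfl
    · exact fun hz => ⟨k, rfl, (hp k z hz).symm⟩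
  have h := (hF j (𝟙 K) p (j ≫ p) ‹_› hj hjp Function.bijective_id hsq).2 b
  simpa using h.symm

/-! ### Skeletality of open 1-mec functors -/

/-- An open `1`-mec functor preserves skeletal surjections with totally disconnected domain. -/
theorem IsOneMec.isSkeletalMap_map_of_totallyDisconnected {F : CompHaus.{u} ⥤ CompHaus.{u}}
    (hF : IsOneMec F) (ho : IsOpenFunctor F) {X Y : CompHaus.{u}} [TotallyDisconnectedSpace X]
    (f : X ⟶ Y) (hs : Function.Surjective f) (hf : IsSkeletalMap f) : IsSkeletalMap (F.map f) := by
  refine isSkeletalMap_of_nonempty_interior_closure_image (F.map f).hom.hom.continuous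
    fun W hW ⟨a, ha⟩ => ?_
  obtain ⟨K, q, V, hK, hq, hV, haV, hVW⟩ := hF.continuous.exists_finite_quotient X W hW a ha
  have : T1Space K := T2Space.t1Space
  have : DiscreteTopology K := Finite.instDiscreteTopology
  have hcl : IsClosedMap f := f.hom.hom.continuous.isClosedMap
  have hfq : ∀ k, (interior (f '' (q ⁻¹' {k}))).Nonempty := fun k => by
    have hop : IsClopen (q ⁻¹' {k}) := (isClopen_discrete {k}).preimage q.hom.hom.continuous
    have := hf.nonempty_interior_closure_image hop.isOpen ((Set.singleton_nonempty k).preimage hq)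
    rwa [(hcl _ hop.isClosed).closure_eq] at this
  obtain ⟨X₁, R, P, i, g, r, p, π, j, h1, h2, hg, hp, hπ, hπo, hjr, hpj⟩ :=
    exists_factorization_through_open f q hs hfq
  have hrj : ∀ k, r (j k) = k := fun k => ConcreteCategory.congr_hom hjr k
  have hFrj : ∀ b, F.map r (F.map j b) = b := fun b => by
    rw [← ConcreteCategory.comp_apply, ← F.map_comp, hjr, F.map_id]
    rfl
  let b : F.obj K := F.map q a
  have hfib := hF.finiteOnePreimages.preimage_map_singleton p j
    (Function.LeftInverse.injective hrj) hpj b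
  have hO : IsOpen (F.map r ⁻¹' V) := hV.preimage (F.map r).hom.hom.continuous
  have hpcl : IsClosedMap (F.map p) := (F.map p).hom.hom.continuous.isClosedMap
  -- The largest subset of `F P` whose preimage under `F p` lies in `(F r)⁻¹ V`; it is open since `F
  -- p` is closed.
  let N : Set (F.obj P) := (F.map p '' (F.map r ⁻¹' V)ᶜ)ᶜ
  have hN : IsOpen N := (hpcl _ hO.isClosed_compl).isOpen_compl
  have hbN : F.map p (F.map j b) ∈ N := by
    rintro ⟨z, hz, hzb⟩
    have : z ∈ ({F.map j b} : Set (F.obj R)) := hfib ▸ hzb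
    rw [Set.mem_singleton_iff] at this
    subst this
    exact hz ((hFrj b).symm ▸ haV : F.map r (F.map j b) ∈ V)
  have hsub : F.map π '' N ⊆ F.map f '' W := by
    rintro _ ⟨n, hn, rfl⟩
    obtain ⟨z, rfl⟩ := hF.epimorphic p hp n
    obtain ⟨x, rfl⟩ := hF.epimorphic g hg z
    refine ⟨F.map i x, hVW ?_, ?_⟩
    · by_contra hx
      refine hn ⟨F.map g x, fun hx' => hx ?_, rfl⟩
      have : F.map q (F.map i x) = F.map r (F.map g x) := by
        rw [← ConcreteCategory.comp_apply, ← F.map_comp, h2, F.map_comp]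
        rfl
      exact (this ▸ hx' : F.map q (F.map i x) ∈ V)
    · rw [← ConcreteCategory.comp_apply, ← F.map_comp, h1, F.map_comp, F.map_comp]
      rfl
  exact ⟨_, interior_maximal (hsub.trans subset_closure) (ho π hπ hπo N hN) ⟨_, hbN, rfl⟩⟩

theorem IsOneMec.isSkeletalFunctor {F : CompHaus.{u} ⥤ CompHaus.{u}} (hF : IsOneMec F)
    (ho : IsOpenFunctor F) : IsSkeletalFunctor F := by
  intro X Y f hs hf
  obtain ⟨E, e, hE, hes, hesk⟩ := exists_skeletal_cover X
  have h : IsSkeletalMap (F.map (e ≫ f)) :=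
    hF.isSkeletalMap_map_of_totallyDisconnected ho (e ≫ f) (hs.comp hes) (hf.comp hesk)
  rw [F.map_comp] at h
  exact IsSkeletalMap.of_comp_surjective (f := F.map e) h (F.map f).hom.hom.continuous
    (F.map e).hom.hom.continuous (hF.epimorphic e hes)

end CompFunctor

theorem corollary1p2 (F : CompHaus.{u} ⥤ CompHaus.{u}) (hopen : CompFunctor.IsOpenFunctor F) :
    (CompFunctor.IsOneMec F → CompFunctor.IsSkeletalFunctor F) ∧
      (CompFunctor.IsNormal F → CompFunctor.IsSkeletalFunctor F) :=
  ⟨fun h => h.isSkeletalFunctor hopen, fun h => h.isOneMec.isSkeletalFunctor hopen⟩
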